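/- Polynomials $P$ on $\mathbb{R}^d$ have complex coefficients; $P(\partial)$ is the corresponding constant coefficient differential operator, so that $P(\partial)e^{i\lambda\cdot x}=P(i\lambda)e^{i\lambda\cdot x}$. The Fourier transform is normalized by $\mathcal F\varphi(\lambda)=(2\pi)^{-d/2}\int_{\mathbb{R}^d}\varphi(x)e^{-i\lambda\cdot x}\,dx$ for Schwartz functions $\varphi$, and $\langle\mathcal F T,\varphi\rangle=\langle T,\mathcal F\varphi\rangle$ for tempered distributions $T$. For a tempered distribution $T$ put $R(P,T)=\sup\{|P(i\lambda)|:\lambda\in\operatorname{supp}T\}\in[0,\infty]$, with $R(P,0)=0$. Let $f\in C^\infty(\mathbb{R}^d)$ be a tempered distribution (i.e. the distribution $\varphi\mapsto\int f\varphi$ on $C_c^\infty(\mathbb{R}^d)$ extends continuously to the Schwartz space) such that $\operatorname{supp}\mathcal F f$ is compact. For a polynomial $P$ let $\widetilde R(P,f)$ be the infimum of all $R\ge 0$ for which there exist $N\in\{0,1,2,\dots\}$ and $C\ge 0$ such that $$|P(\partial)^nf(x)|\le C\,n^N R^n(1+|x|)^N\qquad\text{for all } n\in\{1,2,\dots\},\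 x\in\mathbb{R}^d .$$ Say that a set $\mathcal P$ of polynomials determines a compact set $K\subset\mathbb{R}^d$ if $K=\bigcap_{P\in\mathcal P}\{\lambda\in\mathbb{R}^d:|P(i\lambda)|\le\max_{\mu\in K}|P(i\mu)|\}$, where the maximum is read as $0$ if $K=\emptyset$. Then: 1. For every polynomial $P$, $\widetilde R(P,f)$ is finite and $\widetilde R(P,f)=R(P,\mathcal F f)$. 2. Let $K\subset\mathbb{R}^d$ be non-empty and compact, and let $\mathcal P_K$ be any set of polynomials determining $K$. Then $\operatorname{supp}\mathcal F f\subset K$ if and only if $\widetilde R(P,f)\le\max_{\lambda\in K}|P(i\lambda)|$ for all $P\in\mathcal P_K$. 3. Let $\mathcal P$ be any set of polynomials determining $\operatorname{supp}\mathcal F f$. Then $\lambda\in\mathbb{R}^d$ lies in $\operatorname{supp}\mathcal F f$ if and only if $|P(i\lambda)|\le\widetilde R(P,f)$ for all $P\in\mathcal P$. 4. $\operatorname{supp}\mathcal F f=\{\lambda\in\mathbb{R}^d:|P(i\lambda)|\le\widetilde R(P,f)\text{ for all polynomials }P\}$. -/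

import Mathlib

open scoped SchwartzMap ContDiff FourierTransform ENNReal NNReal

noncomputable section

namespace RealPaleyWiener

/-- The Euclidean space `ℝ^d`. -/
abbrev Rd (d : ℕ) : Type := EuclideanSpace ℝ (Fin d)

/-- The value `P(iξ)` of a complex polynomial `P` in `d` variables at `iξ`, for `ξ ∈ ℝ^d`. -/
def evalI {d : ℕ} (P : MvPolynomial (Fin d) ℂ) (ξ : Rd d) : ℂ :=
  MvPolynomial.eval (fun j => Complex.I * ((ξ j : ℝ) : ℂ)) P

/-! ### Constant coefficient differential operators -/

/-- The partial derivative `∂_j f`. -/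
def partialDeriv {d : ℕ} (j : Fin d) (f : Rd d → ℂ) : Rd d → ℂ :=
  fun x => fderiv ℝ f x (EuclideanSpace.single j (1 : ℝ))

/-- `∂^m f = ∂_0^{m 0} ⋯ ∂_{d-1}^{m (d-1)} f` for a multi-index `m`. -/
def multiDeriv {d : ℕ} (m : Fin d →₀ ℕ) (f : Rd d → ℂ) : Rd d → ℂ :=
  (List.finRange d).foldr (fun j g => (partialDeriv j)^[m j] g) f

/-- `P(∂) f = ∑_m c_m ∂^m f` for a polynomial `P = ∑_m c_m X^m`. -/
def diffOp {d : ℕ} (P : MvPolynomial (Fin d) ℂ) (f : Rd d → ℂ) : Rd d → ℂ :=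
  fun x => ∑ m ∈ P.support, P.coeff m * multiDeriv m f x

/-! ### The Fourier transform, unitary normalization -/

/-- The dilation `ξ ↦ ξ / (2π)`. -/
def dilation (d : ℕ) : Rd d ≃L[ℝ] Rd d :=
  ContinuousLinearEquiv.smulLeft (Units.mk0 ((2 * Real.pi)⁻¹ : ℝ) (by positivity))

/-- The Fourier transform on Schwartz functions, normalized as
`(ℱ φ)(ξ) = (2π)^{-d/2} ∫ φ(x) e^{-i ξ·x} dx`; see `fourierS_apply`. -/
def fourierS (d : ℕ) : 𝓢(Rd d, ℂ) →L[ℂ] 𝓢(Rd d, ℂ) :=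
  (((2 * Real.pi) ^ (-(d : ℝ) / 2) : ℝ) : ℂ) •
    (SchwartzMap.compCLMOfContinuousLinearEquiv ℂ (dilation d)).comp
      (FourierTransform.fourierCLM ℂ 𝓢(Rd d, ℂ))

theorem fourierS_apply {d : ℕ} (φ : 𝓢(Rd d, ℂ)) (ξ : Rd d) :
    fourierS d φ ξ = (((2 * Real.pi) ^ (-(d : ℝ) / 2) : ℝ) : ℂ) *
      ∫ x : Rd d, φ x * Complex.exp (-Complex.I * ((∑ j, ξ j * x j : ℝ) : ℂ)) := by
  have hpi : (Real.pi : ℂ) ≠ 0 := by exact_mod_cast Real.pi_ne_zero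
  have h1 : fourierS d φ ξ = (((2 * Real.pi) ^ (-(d : ℝ) / 2) : ℝ) : ℂ) *
      (𝓕 φ) (dilation d ξ) := rfl
  have h2 : dilation d ξ = (2 * Real.pi)⁻¹ • ξ := rfl
  rw [h1, h2, SchwartzMap.fourier_coe, Real.fourier_eq']
  congr 2
  ext x
  rw [smul_eq_mul, mul_comm, inner_smul_right, PiLp.inner_apply]
  congr 2
  push_cast
  simp only [RCLike.inner_apply, conj_trivial]
  push_cast
  field_simp

/-- The Fourier transform of a tempered distribution: `⟨ℱ T, φ⟩ = ⟨T, ℱ φ⟩`. -/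
def fourierT {d : ℕ} (T : 𝓢'(Rd d, ℂ)) : 𝓢'(Rd d, ℂ) :=
  PointwiseConvergenceCLM.precomp ℂ (fourierS d) T

theorem fourierT_apply {d : ℕ} (T : 𝓢'(Rd d, ℂ)) (φ : 𝓢(Rd d, ℂ)) :
    fourierT T φ = T (fourierS d φ) := rfl

/-- The tempered distribution `T` is (the extension to Schwartz functions of) the distribution
`φ ↦ ∫ f φ` on compactly supported smooth functions. Since these are dense in the Schwartz space,
`T` is determined by `f`. -/
def Represents {d : ℕ} (f : Rd d → ℂ) (T : 𝓢'(Rd d, ℂ)) : Prop :=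
  ∀ φ : 𝓢(Rd d, ℂ), HasCompactSupport (φ : Rd d → ℂ) → T φ = ∫ x : Rd d, f x * φ x

/-! ### The quantities `R(P, T)` and `R̃(P, f)` -/

/-- `sup_{ξ ∈ S} |P(iξ)|` in `[0, ∞]`; it is a maximum if `S` is compact and non-empty, and `0` if
`S` is empty. -/
def supOn {d : ℕ} (P : MvPolynomial (Fin d) ℂ) (S : Set (Rd d)) : ℝ≥0∞ :=
  ⨆ ξ ∈ S, ‖evalI P ξ‖ₑ

/-- `R(P, T) = sup {|P(iξ)| : ξ ∈ supp T}` in `[0, ∞]`, which is `0` if `T = 0`. -/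
def supportRadius {d : ℕ} (P : MvPolynomial (Fin d) ℂ) (T : 𝓢'(Rd d, ℂ)) : ℝ≥0∞ :=
  supOn P (Distribution.dsupport T)

/-- There are `N ∈ ℕ₀` and `C ≥ 0` with `|P(∂)^n f(x)| ≤ C n^N R^n (1 + |x|)^N` for all integers
`n ≥ 1` and all `x`. -/
def GrowthBound {d : ℕ} (P : MvPolynomial (Fin d) ℂ) (f : Rd d → ℂ) (R : ℝ≥0) : Prop :=
  ∃ (N : ℕ) (C : ℝ), 0 ≤ C ∧ ∀ n : ℕ, 1 ≤ n → ∀ x : Rd d,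
    ‖(diffOp P)^[n] f x‖ ≤ C * (n : ℝ) ^ N * (R : ℝ) ^ n * (1 + ‖x‖) ^ N

/-- `R̃(P, f)`: the infimum in `[0, ∞]` of all `R ≥ 0` with `GrowthBound P f R`; it is `∞` if there
is no such `R`. -/
def growthExponent {d : ℕ} (P : MvPolynomial (Fin d) ℂ) (f : Rd d → ℂ) : ℝ≥0∞ :=
  ⨅ (R : ℝ≥0) (_ : GrowthBound P f R), (R : ℝ≥0∞)

/-- The set `𝒬` of polynomials determines `K`:
`K = ⋂_{P ∈ 𝒬} {ξ : |P(iξ)| ≤ sup_{η ∈ K} |P(iη)|}`. -/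
def Determines {d : ℕ} (𝒬 : Set (MvPolynomial (Fin d) ℂ)) (K : Set (Rd d)) : Prop :=
  K = ⋂ P ∈ 𝒬, {ξ : Rd d | ‖evalI P ξ‖ₑ ≤ supOn P K}

end RealPaleyWiener

end

/-!
`P(∂)ⁿ f` is the inverse Fourier transform of `P(i·)ⁿ ℱ f`, so the growth of the former is governed
by the size of `P(i·)` on `supp ℱ f`.

If `|P(i·)| < R` on `supp ℱ f`, cut `P(i·)` off to a test function `p` with `sup |p| < R` that is
unchanged near the support. A weighted norm of `l`-jets is submultiplicative, and for small weights
it is `< R` on `p`, so `pⁿ` is `O(Rⁿ)` in `C^l`. Testing against a mollifier at `x`, whose inverse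
Fourier transform has derivatives of order `≤ l` bounded by a multiple of `(1 + |x|)^l`, gives the
pointwise bound on `P(∂)ⁿ f`.

Conversely, suppose `P(∂)ⁿ f` grows with exponent `R`. For a test function `u` supported in
`{|P(i·)| > R}`, write `⟨ℱ f, u⟩ = ⟨P(i·)ⁿ ℱ f, P(i·)⁻ⁿ u⟩`. By the same estimate of powers, now for
`P(i·)⁻¹` near `supp u`, this tends to `0`. Hence `|P(i·)| ≤ R` on `supp ℱ f`.

So `R̃(P, f)` is the supremum of `|P(i·)|` on `supp ℱ f`, and the remaining assertions only compare
such suprema. All polynomials together determine a compact set `K`, since for `ξ ∉ K` and large `M`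
the polynomial with values `M - |· - ξ|²` is positive on `K` and has a larger value at `ξ`.
-/

noncomputable section

namespace RealPaleyWiener

open Filter Topology Set LineDeriv MeasureTheory SchwartzMap

section JetNorm

variable {E : Type*} [NormedAddCommGroup E] [NormedSpace ℝ E]
  {𝔸 : Type*} [NormedRing 𝔸] [NormedAlgebra ℝ 𝔸]

/-- The norm `∑_{j ≤ l} ε^j / j! ‖D^j f(x)‖` of the `l`-jet of `f` at `x`. The factorials make it
submultiplicative, and the scale `ε` makes it close to `‖f x‖`. -/
def jetNorm (l : ℕ) (ε : ℝ) (f : E → 𝔸) (x : E) : ℝ :=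
  ∑ j ∈ Finset.range (l + 1), ε ^ j / j.factorial * ‖iteratedFDeriv ℝ j f x‖

theorem jetNorm_nonneg (l : ℕ) {ε : ℝ} (hε : 0 ≤ ε) (f : E → 𝔸) (x : E) :
    0 ≤ jetNorm l ε f x :=
  Finset.sum_nonneg fun _ _ => by positivity

theorem norm_iteratedFDeriv_le_jetNorm {j l : ℕ} (hj : j ≤ l) {ε : ℝ} (hε : 0 < ε) (f : E → 𝔸)
    (x : E) : ‖iteratedFDeriv ℝ j f x‖ ≤ j.factorial / ε ^ j * jetNorm l ε f x := by
  have hterm : ε ^ j / j.factorial * ‖iteratedFDeriv ℝ j f x‖ ≤ jetNorm l ε f x :=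
    Finset.single_le_sum (f := fun j => ε ^ j / j.factorial * ‖iteratedFDeriv ℝ j f x‖)
      (fun _ _ => by positivity) (Finset.mem_range.2 (by lia))
  calc ‖iteratedFDeriv ℝ j f x‖
      = j.factorial / ε ^ j * (ε ^ j / j.factorial * ‖iteratedFDeriv ℝ j f x‖) := by field_simp
    _ ≤ j.factorial / ε ^ j * jetNorm l ε f x := by gcongr

theorem jetNorm_mul_le {l : ℕ} {ε : ℝ} (hε : 0 ≤ ε) {f g : E → 𝔸} (hf : ContDiff ℝ l f)
    (hg : ContDiff ℝ l g) (x : E) :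
    jetNorm l ε (fun y => f y * g y) x ≤ jetNorm l ε f x * jetNorm l ε g x := by
  let a : (E → 𝔸) → ℕ → ℝ := fun h j => ε ^ j / j.factorial * ‖iteratedFDeriv ℝ j h x‖
  have ha : ∀ h j, 0 ≤ a h j := fun h j => by positivity
  have hleibniz : ∀ j ≤ l,
      a (fun y => f y * g y) j ≤ ∑ i ∈ Finset.range (j + 1), a f i * a g (j - i) := by
    intro j hj
    refine (mul_le_mul_of_nonneg_left (norm_iteratedFDeriv_mul_le hf hg x
      (by exact_mod_cast hj)) (by positivity)).trans_eq ?_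
    rw [Finset.mul_sum]
    refine Finset.sum_congr rfl fun i hi => ?_
    have hij : i ≤ j := Nat.lt_succ_iff.1 (Finset.mem_range.1 hi)
    have hpow : ε ^ j = ε ^ i * ε ^ (j - i) := by rw [← pow_add, Nat.add_sub_cancel' hij]
    simp only [a]
    rw [Nat.cast_choose ℝ hij, hpow]
    field_simp
  calc jetNorm l ε (fun y => f y * g y) x
      ≤ ∑ j ∈ Finset.range (l + 1), ∑ i ∈ Finset.range (j + 1), a f i * a g (j - i) :=
        Finset.sum_le_sum fun j hj => hleibniz j (Nat.lt_succ_iff.1 (Finset.mem_range.1 hj))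
    _ = ∑ i ∈ Finset.range (l + 1), ∑ k ∈ Finset.range (l + 1 - i), a f i * a g k :=
        Finset.sum_range_diag_flip (l + 1) fun i k => a f i * a g k
    _ ≤ ∑ i ∈ Finset.range (l + 1), ∑ k ∈ Finset.range (l + 1), a f i * a g k :=
        Finset.sum_le_sum fun i _ => Finset.sum_le_sum_of_subset_of_nonneg
          (Finset.range_subset_range.2 (Nat.sub_le _ _)) fun k _ _ => mul_nonneg (ha f i) (ha g k)
    _ = jetNorm l ε f x * jetNorm l ε g x := (Finset.sum_mul_sum _ _ _ _).symm

theorem jetNorm_one [NormOneClass 𝔸] (l : ℕ) (ε : ℝ) (x : E) :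
    jetNorm l ε (1 : E → 𝔸) x = 1 := by
  rw [jetNorm, Finset.sum_range_succ', Finset.sum_eq_zero fun j _ => ?_]
  · simp
  · rw [show (1 : E → 𝔸) = fun _ => 1 from rfl, iteratedFDeriv_const_of_ne j.succ_ne_zero]
    simp

theorem jetNorm_pow_le [NormOneClass 𝔸] {l : ℕ} {ε : ℝ} (hε : 0 ≤ ε) {f : E → 𝔸}
    (hf : ContDiff ℝ l f) (x : E) (n : ℕ) : jetNorm l ε (f ^ n) x ≤ jetNorm l ε f x ^ n := by
  induction n with
  | zero => simp [jetNorm_one]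
  | succ n ih =>
    rw [pow_succ, pow_succ]
    exact (jetNorm_mul_le hε (hf.pow n) hf x).trans
      (mul_le_mul_of_nonneg_right ih (jetNorm_nonneg l hε f x))

theorem jetNorm_le_norm_add {l : ℕ} {ε M : ℝ} (hε₀ : 0 ≤ ε) (hε₁ : ε ≤ 1) {f : E → 𝔸} {x : E}
    (hM : ∀ j ≤ l, ‖iteratedFDeriv ℝ j f x‖ ≤ M) :
    jetNorm l ε f x ≤ ‖f x‖ + ε * (l * M) := by
  have : 0 ≤ M := (norm_nonneg _).trans (hM 0 l.zero_le)
  have hterm : ∀ j ∈ Finset.range l,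
      ε ^ (j + 1) / (j + 1).factorial * ‖iteratedFDeriv ℝ (j + 1) f x‖ ≤ ε * M := by
    intro j hj
    have hcoef : ε ^ (j + 1) / (j + 1).factorial ≤ ε := calc
      _ ≤ ε ^ (j + 1) := div_le_self (by positivity) (by exact_mod_cast Nat.factorial_pos _)
      _ ≤ ε := pow_le_of_le_one hε₀ hε₁ j.succ_ne_zero
    have := hM (j + 1) (Finset.mem_range.1 hj)
    gcongr
  rw [jetNorm, Finset.sum_range_succ', add_comm]
  refine add_le_add (by simp) ((Finset.sum_le_card_nsmul _ _ _ hterm).trans_eq ?_)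
  rw [Finset.card_range, nsmul_eq_mul]
  ring

theorem exists_norm_iteratedFDeriv_pow_le [NormOneClass 𝔸] {p : E → 𝔸} {l : ℕ}
    (hp : ContDiff ℝ l p) {M R' R : ℝ} (hM : ∀ j ≤ l, ∀ x, ‖iteratedFDeriv ℝ j p x‖ ≤ M)
    (hR' : ∀ x, ‖p x‖ ≤ R') (hR : R' < R) :
    ∃ C, ∀ n : ℕ, ∀ j ≤ l, ∀ x, ‖iteratedFDeriv ℝ j (p ^ n) x‖ ≤ C * R ^ n := by
  obtain ⟨ε, hε₀, hε₁, hε⟩ : ∃ ε : ℝ, 0 < ε ∧ ε ≤ 1 ∧ R' + ε * (l * M) ≤ R := by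
    have hlim : Tendsto (fun ε : ℝ => R' + ε * (l * M)) (𝓝[>] 0) (𝓝 R') :=
      (Continuous.tendsto' (by fun_prop) 0 R' (by simp)).mono_left nhdsWithin_le_nhds
    obtain ⟨ε, hεR, hε⟩ :=
      ((hlim.eventually (ge_mem_nhds hR)).and (Ioc_mem_nhdsGT zero_lt_one)).exists
    exact ⟨ε, hε.1, hε.2, hεR⟩
  refine ⟨l.factorial / ε ^ l, fun n j hj x => ?_⟩
  have hjet : jetNorm l ε p x ≤ R :=
    (jetNorm_le_norm_add hε₀.le hε₁ fun j hj => hM j hj x).trans (by linarith [hR' x])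
  calc ‖iteratedFDeriv ℝ j (p ^ n) x‖ ≤ j.factorial / ε ^ j * jetNorm l ε (p ^ n) x :=
        norm_iteratedFDeriv_le_jetNorm hj hε₀ _ x
    _ ≤ l.factorial / ε ^ l * R ^ n := by
        have hpow := (jetNorm_pow_le hε₀.le hp x n).trans
          (pow_le_pow_left₀ (jetNorm_nonneg l hε₀.le p x) hjet n)
        have hscale := pow_le_pow_of_le_one hε₀.le hε₁ hj
        have hfact : (j.factorial : ℝ) ≤ l.factorial := by exact_mod_cast Nat.factorial_le hj
        gcongr
        exact jetNorm_nonneg l hε₀.le _ x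

end JetNorm

section SchwartzNorm

variable {E : Type*} [NormedAddCommGroup E] [NormedSpace ℝ E]

/-- The maximum of the Schwartz seminorms `sup_x ‖x‖^i ‖D^j φ(x)‖` with `i ≤ k` and `j ≤ l`. -/
def schwartzNorm (k l : ℕ) : Seminorm ℝ 𝓢(E, ℂ) :=
  (Finset.Iic (k, l)).sup (schwartzSeminormFamily ℝ E ℂ)

theorem continuous_schwartzNorm (k l : ℕ) :
    Continuous (schwartzNorm k l : Seminorm ℝ 𝓢(E, ℂ)) :=
  Seminorm.continuous_finsetSup fun i _ => (schwartz_withSeminorms ℝ E ℂ).continuous_seminorm i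

theorem pow_mul_norm_iteratedFDeriv_le_schwartzNorm {i j k l : ℕ} (hi : i ≤ k) (hj : j ≤ l)
    (φ : 𝓢(E, ℂ)) (x : E) : ‖x‖ ^ i * ‖iteratedFDeriv ℝ j φ x‖ ≤ schwartzNorm k l φ :=
  (φ.le_seminorm ℝ i j x).trans (Seminorm.le_finset_sup_apply
    (p := schwartzSeminormFamily ℝ E ℂ) (Finset.mem_Iic.2 (Prod.mk_le_mk.2 ⟨hi, hj⟩)))

theorem norm_iteratedFDeriv_le_schwartzNorm {j l : ℕ} (hj : j ≤ l) (k : ℕ) (φ : 𝓢(E, ℂ)) (x : E) :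
    ‖iteratedFDeriv ℝ j φ x‖ ≤ schwartzNorm k l φ := by
  simpa using pow_mul_norm_iteratedFDeriv_le_schwartzNorm k.zero_le hj φ x

theorem schwartzNorm_le_of_forall {k l : ℕ} {φ : 𝓢(E, ℂ)} {B : ℝ}
    (h : ∀ i ≤ k, ∀ j ≤ l, ∀ x, ‖x‖ ^ i * ‖iteratedFDeriv ℝ j φ x‖ ≤ B) :
    schwartzNorm k l φ ≤ B := by
  have hB : 0 ≤ B := le_trans (by positivity) (h 0 k.zero_le 0 l.zero_le 0)
  refine Seminorm.finset_sup_apply_le hB fun m hm => ?_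
  have hm' := Prod.mk_le_mk.1 (Finset.mem_Iic.1 hm)
  exact SchwartzMap.seminorm_le_bound ℝ m.1 m.2 φ hB (h m.1 hm'.1 m.2 hm'.2)

theorem exists_le_schwartzNorm {Q : Seminorm ℝ 𝓢(E, ℂ)} (hQ : Continuous Q) :
    ∃ (C : ℝ) (k l : ℕ), 0 ≤ C ∧ ∀ φ, Q φ ≤ C * schwartzNorm k l φ := by
  obtain ⟨s, C, -, hC⟩ := Seminorm.bound_of_continuous (schwartz_withSeminorms ℝ E ℂ) Q hQ
  refine ⟨C, s.sup Prod.fst, s.sup Prod.snd, C.2, fun φ => (hC φ).trans ?_⟩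
  refine mul_le_mul_of_nonneg_left (Seminorm.finset_sup_apply_le (apply_nonneg _ _) ?_) C.2
  exact fun m hm => Seminorm.le_finset_sup_apply (p := schwartzSeminormFamily ℝ E ℂ) (i := m)
    (Finset.mem_Iic.2 ⟨Finset.le_sup (f := Prod.fst) hm, Finset.le_sup (f := Prod.snd) hm⟩)

theorem mul_norm_iteratedFDeriv_mul_le {a b : E → ℂ} {n : ℕ} (ha : ContDiff ℝ n a)
    (hb : ContDiff ℝ n b) {x : E} {w A B : ℝ} (hw : 0 ≤ w)
    (hA : ∀ i ≤ n, ‖iteratedFDeriv ℝ i a x‖ ≤ A)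
    (hB : ∀ i ≤ n, w * ‖iteratedFDeriv ℝ i b x‖ ≤ B) :
    w * ‖iteratedFDeriv ℝ n (fun y => a y * b y) x‖ ≤ 2 ^ n * A * B := by
  have hA₀ : 0 ≤ A := (norm_nonneg _).trans (hA 0 n.zero_le)
  calc w * ‖iteratedFDeriv ℝ n (fun y => a y * b y) x‖
      ≤ w * ∑ i ∈ Finset.range (n + 1), (n.choose i : ℝ) *
          ‖iteratedFDeriv ℝ i a x‖ * ‖iteratedFDeriv ℝ (n - i) b x‖ := by
        gcongr
        exact norm_iteratedFDeriv_mul_le ha hb x le_rfl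
    _ = ∑ i ∈ Finset.range (n + 1), (n.choose i : ℝ) *
          (‖iteratedFDeriv ℝ i a x‖ * (w * ‖iteratedFDeriv ℝ (n - i) b x‖)) := by
        rw [Finset.mul_sum]
        exact Finset.sum_congr rfl fun i _ => by ring
    _ ≤ ∑ i ∈ Finset.range (n + 1), (n.choose i : ℝ) * (A * B) := by
        refine Finset.sum_le_sum fun i hi => ?_
        have := hA i (Nat.lt_succ_iff.1 (Finset.mem_range.1 hi))
        have := hB (n - i) (Nat.sub_le n i)
        gcongr
    _ = 2 ^ n * A * B := by
        rw [← Finset.sum_mul, ← Nat.cast_sum, Nat.sum_range_choose]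
        push_cast
        ring

theorem coe_smulLeftCLM {a : E → ℂ} (ha : a.HasTemperateGrowth) (φ : 𝓢(E, ℂ)) :
    (smulLeftCLM ℂ a φ : E → ℂ) = fun x => a x * φ x :=
  funext fun x => smulLeftCLM_apply_apply ha φ x

theorem schwartzNorm_smulLeftCLM_le {a : E → ℂ} (ha : a.HasTemperateGrowth) {l : ℕ} {B : ℝ}
    (hB : ∀ i ≤ l, ∀ x, ‖iteratedFDeriv ℝ i a x‖ ≤ B) (k : ℕ) (φ : 𝓢(E, ℂ)) :
    schwartzNorm k l (smulLeftCLM ℂ a φ) ≤ 2 ^ l * B * schwartzNorm k l φ := by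
  have hB₀ : 0 ≤ B := (norm_nonneg _).trans (hB 0 l.zero_le 0)
  refine schwartzNorm_le_of_forall fun i hi j hj x => ?_
  rw [coe_smulLeftCLM ha]
  refine (mul_norm_iteratedFDeriv_mul_le (ha.1.of_le (by exact_mod_cast le_top)) (φ.smooth j)
    (by positivity) (fun i' hi' => hB i' (hi'.trans hj) x) fun i' hi' =>
      pow_mul_norm_iteratedFDeriv_le_schwartzNorm hi (hi'.trans hj) φ x).trans ?_
  have := apply_nonneg (schwartzNorm k l) φ
  gcongr
  norm_num

theorem exists_schwartzNorm_pow_smulLeftCLM_le (p : 𝓢(E, ℂ)) {R' R : ℝ} (hp : ∀ x, ‖p x‖ ≤ R')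
    (hR : R' < R) (k l : ℕ) :
    ∃ C, 0 ≤ C ∧ ∀ (n : ℕ) (φ : 𝓢(E, ℂ)),
      schwartzNorm k l (smulLeftCLM ℂ ((p : E → ℂ) ^ n) φ) ≤ C * R ^ n * schwartzNorm k l φ := by
  obtain ⟨C, hC⟩ := exists_norm_iteratedFDeriv_pow_le (p.smooth l)
    (fun j hj x => norm_iteratedFDeriv_le_schwartzNorm hj 0 p x) hp hR
  have hC₀ : 0 ≤ C := by simpa using (norm_nonneg _).trans (hC 0 0 l.zero_le 0)
  refine ⟨2 ^ l * C, by positivity, fun n φ => ?_⟩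
  refine (schwartzNorm_smulLeftCLM_le (p.hasTemperateGrowth.pow n) (hC n) k φ).trans_eq ?_
  ring

theorem exists_pow_smulLeftCLM_le {Q : Seminorm ℝ 𝓢(E, ℂ)} (hQ : Continuous Q) (p : 𝓢(E, ℂ))
    {R' R : ℝ} (hp : ∀ x, ‖p x‖ ≤ R') (hR : R' < R) :
    ∃ (C : ℝ) (k l : ℕ), 0 ≤ C ∧ ∀ (n : ℕ) (φ : 𝓢(E, ℂ)),
      Q (smulLeftCLM ℂ ((p : E → ℂ) ^ n) φ) ≤ C * R ^ n * schwartzNorm k l φ := by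
  obtain ⟨D, k, l, hD, hQD⟩ := exists_le_schwartzNorm hQ
  obtain ⟨C, hC, hpC⟩ := exists_schwartzNorm_pow_smulLeftCLM_le p hp hR k l
  refine ⟨D * C, k, l, by positivity, fun n φ => (hQD _).trans ?_⟩
  calc D * schwartzNorm k l (smulLeftCLM ℂ ((p : E → ℂ) ^ n) φ)
      ≤ D * (C * R ^ n * schwartzNorm k l φ) := by
        gcongr
        exact hpC n φ
    _ = D * C * R ^ n * schwartzNorm k l φ := by ring

end SchwartzNorm

section Cutoff

variable {E : Type*} [NormedAddCommGroup E] [NormedSpace ℝ E]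

theorem exists_schwartz_cutoff [FiniteDimensional ℝ E] {K V : Set E} (hK : IsCompact K)
    (hV : IsOpen V) (hKV : K ⊆ V) :
    ∃ χ : 𝓢(E, ℂ), HasCompactSupport χ ∧ tsupport χ ⊆ V ∧ (∀ᶠ x in 𝓝ˢ K, χ x = 1) ∧
      ∀ x, ‖χ x‖ ≤ 1 := by
  obtain ⟨L, hL, hKL, hLV⟩ := exists_compact_between hK hV hKV
  obtain ⟨g, hg1, hg0, hg⟩ := exists_contMDiffMap_one_nhds_of_subset_interior
    (n := (⊤ : ℕ∞)) (modelWithCornersSelf ℝ E) hK.isClosed hKL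
  have hsub : tsupport (fun x => (g x : ℂ)) ⊆ L :=
    closure_minimal (fun x hx => by_contra fun h => hx (by simp [hg0 x h])) hL.isClosed
  have hc : HasCompactSupport fun x => (g x : ℂ) := hL.of_isClosed_subset isClosed_closure hsub
  have hs : ContDiff ℝ ∞ fun x => (g x : ℂ) :=
    Complex.ofRealCLM.contDiff.comp g.contMDiff.contDiff
  refine ⟨hc.toSchwartzMap hs, hc, hsub.trans hLV, ?_, fun x => ?_⟩
  · filter_upwards [hg1] with x hx
    rw [HasCompactSupport.toSchwartzMap_toFun, hx, Complex.ofReal_one]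
  · rw [HasCompactSupport.toSchwartzMap_toFun, Complex.norm_real, Real.norm_of_nonneg (hg x).1]
    exact (hg x).2

theorem norm_iteratedFDeriv_one_sub_comp_smul_le (χ : 𝓢(E, ℂ)) {ε : ℝ} (hε₀ : 0 ≤ ε)
    (hε₁ : ε ≤ 1) {i n : ℕ} (hi : i ≤ n) (x : E) :
    ‖iteratedFDeriv ℝ i (fun y => 1 - χ (ε • y)) x‖ ≤ 1 + schwartzNorm 0 n χ := by
  have hone : ‖iteratedFDeriv ℝ i (fun _ : E => (1 : ℂ)) x‖ ≤ 1 := by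
    rcases i.eq_zero_or_pos with rfl | hpos
    · simp
    · simp [iteratedFDeriv_const_of_ne hpos.ne']
  have hχ : ‖iteratedFDeriv ℝ i (fun y => χ (ε • y)) x‖ ≤ schwartzNorm 0 n χ := by
    rw [iteratedFDeriv_comp_const_smul ε (χ.smooth i), norm_smul, norm_pow,
      Real.norm_of_nonneg hε₀]
    exact (mul_le_of_le_one_left (norm_nonneg _) (pow_le_one₀ hε₀ hε₁)).trans
      (norm_iteratedFDeriv_le_schwartzNorm hi 0 χ _)
  have hsub : iteratedFDeriv ℝ i (fun y => 1 - χ (ε • y)) x =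
      iteratedFDeriv ℝ i (fun _ : E => (1 : ℂ)) x - iteratedFDeriv ℝ i (fun y => χ (ε • y)) x :=
    iteratedFDeriv_sub_apply contDiffAt_const
      ((χ.smooth i).comp (contDiff_const_smul ε)).contDiffAt
  exact hsub ▸ (norm_sub_le _ _).trans (add_le_add hone hχ)

theorem seminorm_smulLeftCLM_le_of_eq_zero_on_ball {a : E → ℂ} (ha : a.HasTemperateGrowth)
    {r : ℝ} (hr : 0 < r) (har : ∀ x, ‖x‖ < r → a x = 0) {l : ℕ} {B : ℝ}
    (hB : ∀ i ≤ l, ∀ x, ‖iteratedFDeriv ℝ i a x‖ ≤ B) (k : ℕ) (φ : 𝓢(E, ℂ)) :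
    SchwartzMap.seminorm ℝ k l (smulLeftCLM ℂ a φ) ≤
      r⁻¹ * (2 ^ l * B * schwartzNorm (k + 1) l φ) := by
  have hB₀ : 0 ≤ B := (norm_nonneg _).trans (hB 0 l.zero_le 0)
  have := apply_nonneg (schwartzNorm (k + 1) l) φ
  refine SchwartzMap.seminorm_le_bound ℝ k l _ (by positivity) fun x => ?_
  rw [coe_smulLeftCLM ha]
  rcases lt_or_ge ‖x‖ r with hx | hx
  · have hzero : (fun y => a y * φ y) =ᶠ[𝓝 x] fun _ => 0 := by
      filter_upwards [continuous_norm.continuousAt.eventually_lt continuousAt_const hx] with y hy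
      rw [har y hy, zero_mul]
    rw [(hzero.iteratedFDeriv ℝ l).self_of_nhds]
    simp only [iteratedFDeriv_fun_zero, Pi.zero_apply, norm_zero, mul_zero]
    positivity
  · have hweight : ‖x‖ ^ k ≤ r⁻¹ * ‖x‖ ^ (k + 1) := by
      rw [le_inv_mul_iff₀ hr, pow_succ, mul_comm]
      gcongr
    have hleibniz := mul_norm_iteratedFDeriv_mul_le (ha.1.of_le (by exact_mod_cast le_top))
      (φ.smooth l) (pow_nonneg (norm_nonneg x) (k + 1)) (fun i hi => hB i hi x) fun i hi =>
        pow_mul_norm_iteratedFDeriv_le_schwartzNorm le_rfl hi φ x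
    calc _ ≤ r⁻¹ * ‖x‖ ^ (k + 1) * ‖iteratedFDeriv ℝ l (fun y => a y * φ y) x‖ := by gcongr
      _ ≤ _ := by
        rw [mul_assoc]
        gcongr

theorem hasTemperateGrowth_comp_smul {χ : 𝓢(E, ℂ)} (hχ : HasCompactSupport χ) {ε : ℝ}
    (hε : ε ≠ 0) : (fun x => χ (ε • x)).HasTemperateGrowth :=
  (hχ.comp_smul hε).hasTemperateGrowth ((χ.smooth ⊤).comp (contDiff_const_smul _))

/-- The error `(1 - χ (ε x)) φ` lives on `‖x‖ ≥ 1 / ε`, where one weight `‖x‖` gains a factor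
`ε`. -/
theorem seminorm_smulLeftCLM_comp_smul_sub_le {χ : 𝓢(E, ℂ)} (hχc : HasCompactSupport χ)
    (hχ1 : ∀ x, ‖x‖ ≤ 1 → χ x = 1) {ε : ℝ} (hε₀ : 0 < ε) (hε₁ : ε ≤ 1) (k l : ℕ)
    (φ : 𝓢(E, ℂ)) :
    SchwartzMap.seminorm ℝ k l (smulLeftCLM ℂ (fun x => χ (ε • x)) φ - φ) ≤
      ε * (2 ^ l * (1 + schwartzNorm 0 l χ) * schwartzNorm (k + 1) l φ) := by
  have hχε := hasTemperateGrowth_comp_smul hχc hε₀.ne'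
  have hcut : (fun x => 1 - χ (ε • x)).HasTemperateGrowth :=
    (Function.HasTemperateGrowth.const 1).sub hχε
  have hball : ∀ x, ‖x‖ < ε⁻¹ → 1 - χ (ε • x) = 0 := fun x hx => by
    refine sub_eq_zero.2 (hχ1 _ ?_).symm
    rw [norm_smul, Real.norm_of_nonneg hε₀.le, ← le_inv_mul_iff₀ hε₀, mul_one]
    exact hx.le
  have herr : smulLeftCLM ℂ (fun x => χ (ε • x)) φ - φ =
      -smulLeftCLM ℂ (fun x => 1 - χ (ε • x)) φ := by
    ext x
    simp only [sub_apply, neg_apply, coe_smulLeftCLM hχε, coe_smulLeftCLM hcut]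
    ring
  rw [herr, map_neg_eq_map]
  simpa only [inv_inv] using seminorm_smulLeftCLM_le_of_eq_zero_on_ball hcut (inv_pos.2 hε₀)
    hball (fun i hi => norm_iteratedFDeriv_one_sub_comp_smul_le χ hε₀.le hε₁ hi) k φ

theorem mem_closure_hasCompactSupport [FiniteDimensional ℝ E] (φ : 𝓢(E, ℂ)) :
    φ ∈ closure {u : 𝓢(E, ℂ) | HasCompactSupport u ∧ tsupport u ⊆ tsupport φ} := by
  obtain ⟨χ, hχc, -, hχ, -⟩ := exists_schwartz_cutoff (isCompact_closedBall (0 : E) 1)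
    isOpen_univ (subset_univ _)
  have hχ1 : ∀ x, ‖x‖ ≤ 1 → χ x = 1 := fun x hx =>
    hχ.self_of_nhdsSet x (mem_closedBall_zero_iff.2 hx)
  have hε : ∀ᶠ ε : ℝ in 𝓝[>] 0, 0 < ε ∧ ε ≤ 1 := Ioc_mem_nhdsGT zero_lt_one
  refine mem_closure_of_tendsto (f := fun ε : ℝ => smulLeftCLM ℂ (fun x => χ (ε • x)) φ)
    (b := 𝓝[>] 0) ?_ ?_
  · rw [(schwartz_withSeminorms ℝ E ℂ).tendsto_nhds _ φ]
    rintro ⟨k, l⟩ δ hδ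
    have hlim : Tendsto (fun ε : ℝ => ε *
        (2 ^ l * (1 + schwartzNorm 0 l χ) * schwartzNorm (k + 1) l φ)) (𝓝[>] 0) (𝓝 0) :=
      ((continuous_mul_const _).tendsto' _ _ (zero_mul _)).mono_left nhdsWithin_le_nhds
    filter_upwards [hε, hlim.eventually (gt_mem_nhds hδ)] with ε hε hεδ
    exact (seminorm_smulLeftCLM_comp_smul_sub_le hχc hχ1 hε.1 hε.2 k l φ).trans_lt hεδ
  · filter_upwards [hε] with ε hε
    rw [coe_smulLeftCLM (hasTemperateGrowth_comp_smul hχc hε.1.ne')]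
    exact ⟨(hχc.comp_smul hε.1.ne').mul_right, tsupport_mul_subset_right⟩

end Cutoff

section Support

open Distribution

variable {E F : Type*} [NormedAddCommGroup E] [NormedSpace ℝ E] [FiniteDimensional ℝ E]
  [NormedAddCommGroup F] [NormedSpace ℂ F] {U : 𝓢'(E, F)}

theorem isVanishingOn_of_hasCompactSupport {s : Set E}
    (h : ∀ u : 𝓢(E, ℂ), HasCompactSupport u → tsupport u ⊆ s → U u = 0) : IsVanishingOn U s := by
  intro u hu
  have hclosed : IsClosed {v : 𝓢(E, ℂ) | U v = 0} := isClosed_eq U.continuous continuous_const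
  exact closure_minimal (fun v hv => h v hv.1 (hv.2.trans hu)) hclosed
    (mem_closure_hasCompactSupport u)

theorem isVanishingOn_union {V W : Set E} (hV : IsOpen V) (hW : IsOpen W)
    (hUV : IsVanishingOn U V) (hUW : IsVanishingOn U W) : IsVanishingOn U (V ∪ W) := by
  refine isVanishingOn_of_hasCompactSupport fun v hvc hv => ?_
  obtain ⟨χ, -, hχV, hχ1, -⟩ := exists_schwartz_cutoff (hvc.diff hW) hV
    fun x hx => (hv hx.1).resolve_right hx.2
  have hχv : U (smulLeftCLM ℂ χ v) = 0 := hUV _ <| by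
    rw [coe_smulLeftCLM χ.hasTemperateGrowth]
    exact tsupport_mul_subset_left.trans hχV
  have hcoe : ((v - smulLeftCLM ℂ χ v : 𝓢(E, ℂ)) : E → ℂ) = fun x => (1 - χ x) * v x := by
    ext x
    simp only [sub_apply, coe_smulLeftCLM χ.hasTemperateGrowth]
    ring
  have hrest : U (v - smulLeftCLM ℂ χ v) = 0 := hUW _ fun x hx => by_contra fun hxW => by
    rw [hcoe] at hx
    have hxv : x ∈ tsupport v \ W := ⟨tsupport_mul_subset_right hx, hxW⟩
    refine notMem_tsupport_iff_eventuallyEq.2 ?_ hx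
    filter_upwards [hχ1.filter_mono (nhds_le_nhdsSet hxv)] with y hy
    simp [hy]
  rwa [map_sub, hχv, sub_zero] at hrest

theorem isVanishingOn_compl_dsupport : IsVanishingOn U (dsupport U)ᶜ := by
  refine isVanishingOn_of_hasCompactSupport fun u huc hu => ?_
  obtain ⟨V, -, huV, hV⟩ : ∃ V, IsOpen V ∧ tsupport u ⊆ V ∧ IsVanishingOn U V := by
    refine IsCompact.induction_on (p := fun A => ∃ V, IsOpen V ∧ A ⊆ V ∧ IsVanishingOn U V)
      huc ?_ ?_ ?_ fun x hx => ?_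
    · refine ⟨∅, isOpen_empty, subset_rfl, fun v hv => ?_⟩
      have hv0 : v = 0 :=
        DFunLike.coe_injective (tsupport_eq_empty_iff.1 (subset_empty_iff.1 hv))
      rw [hv0, map_zero]
    · rintro A B hAB ⟨V, hV, hBV, hUV⟩
      exact ⟨V, hV, hAB.trans hBV, hUV⟩
    · rintro A B ⟨V, hV, hAV, hUV⟩ ⟨W, hW, hBW, hUW⟩
      exact ⟨V ∪ W, hV.union hW, union_subset_union hAV hBW, isVanishingOn_union hV hW hUV hUW⟩
    · obtain ⟨V, hUV, hV, hxV⟩ := (notMem_dsupport_iff x).1 (hu hx)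
      exact ⟨V, mem_nhdsWithin_of_mem_nhds (hV.mem_nhds hxV), V, hV, subset_rfl, hUV⟩
  exact hV u huV

theorem apply_eq_of_eventuallyEq_nhdsSet_dsupport {u v : 𝓢(E, ℂ)}
    (h : ∀ᶠ x in 𝓝ˢ (dsupport U), u x = v x) : U u = U v := by
  rw [← sub_eq_zero, ← map_sub]
  refine isVanishingOn_compl_dsupport _ fun x hx hxU =>
    notMem_tsupport_iff_eventuallyEq.2 ?_ hx
  filter_upwards [h.filter_mono (nhds_le_nhdsSet hxU)] with y hy
  simp [hy]

end Support

section Powers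

open Distribution

variable {E F : Type*} [NormedAddCommGroup E] [NormedSpace ℝ E] [FiniteDimensional ℝ E]
  [NormedAddCommGroup F] [NormedSpace ℂ F] {U : 𝓢'(E, F)} {a : E → ℂ}

/-- The seminorm `φ ↦ ‖U φ‖`. -/
def normApply {E F : Type*} [NormedAddCommGroup E] [NormedSpace ℝ E] [NormedAddCommGroup F]
    [NormedSpace ℂ F] (U : 𝓢'(E, F)) : Seminorm ℝ 𝓢(E, ℂ) :=
  ((normSeminorm ℂ F).comp U.toLinearMap).restrictScalars ℝ

/-- Write `a ^ n` near `dsupport U` as the `n`-th power of a Schwartz function `p` with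
`sup ‖p‖ < R`. -/
theorem exists_norm_smulLeftCLM_pow_apply_le (hU : IsCompact (dsupport U))
    (ha : a.HasTemperateGrowth) {R : ℝ} (hR : 0 < R) (haR : ∀ x ∈ dsupport U, ‖a x‖ < R) :
    ∃ (C : ℝ) (l : ℕ), 0 ≤ C ∧ ∀ (n : ℕ) (φ : 𝓢(E, ℂ)),
      ‖TemperedDistribution.smulLeftCLM F (a ^ n) U φ‖ ≤ C * R ^ n * schwartzNorm 0 l φ := by
  have hnorm : Continuous fun x => ‖a x‖ := ha.1.continuous.norm
  obtain ⟨χ, hχc, hχV, hχ1, hχ⟩ :=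
    exists_schwartz_cutoff hU (isOpen_lt hnorm continuous_const) haR
  obtain ⟨R₁, hR₁, haR₁⟩ : ∃ R₁ < R, ∀ x ∈ tsupport χ, ‖a x‖ ≤ R₁ :=
    IsCompact.exists_forall_le' (α := ℝᵒᵈ) hχc hnorm.continuousOn hχV
  let p : 𝓢(E, ℂ) := smulLeftCLM ℂ a χ
  have hpa : ∀ x, p x = a x * χ x := fun x => smulLeftCLM_apply_apply ha χ x
  have hp : ∀ x, ‖p x‖ ≤ max R₁ 0 := fun x => by
    rw [hpa, norm_mul]
    by_cases hx : x ∈ tsupport χ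
    · exact (mul_le_of_le_one_right (norm_nonneg _) (hχ x)).trans
        ((haR₁ x hx).trans (le_max_left _ _))
    · simp [image_eq_zero_of_notMem_tsupport hx]
  obtain ⟨C, k, l, hC, hCU⟩ := exists_pow_smulLeftCLM_le (Q := normApply U)
    (continuous_norm.comp U.continuous) p hp (max_lt hR₁ hR)
  have := apply_nonneg (schwartzNorm k l) χ
  refine ⟨C * 2 ^ l * schwartzNorm k l χ, l, by positivity, fun n φ => ?_⟩
  have heq : TemperedDistribution.smulLeftCLM F (a ^ n) U φ =
      U (smulLeftCLM ℂ ((p : E → ℂ) ^ n) (smulLeftCLM ℂ φ χ)) := by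
    rw [TemperedDistribution.smulLeftCLM_apply_apply]
    refine apply_eq_of_eventuallyEq_nhdsSet_dsupport ?_
    filter_upwards [hχ1] with x hx
    simp [coe_smulLeftCLM (ha.pow n), coe_smulLeftCLM (p.hasTemperateGrowth.pow n),
      coe_smulLeftCLM φ.hasTemperateGrowth, hpa, hx]
  have hφχ := schwartzNorm_smulLeftCLM_le (l := l) φ.hasTemperateGrowth
    (fun i hi x => norm_iteratedFDeriv_le_schwartzNorm hi 0 φ x) k χ
  calc ‖TemperedDistribution.smulLeftCLM F (a ^ n) U φ‖
      ≤ C * R ^ n * schwartzNorm k l (smulLeftCLM ℂ φ χ) := heq ▸ hCU n _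
    _ ≤ C * R ^ n * (2 ^ l * schwartzNorm 0 l φ * schwartzNorm k l χ) := by gcongr
    _ = C * 2 ^ l * schwartzNorm k l χ * R ^ n * schwartzNorm 0 l φ := by ring

theorem exists_schwartz_mul_eq_one (ha : ContDiff ℝ ∞ a) {K : Set E} (hK : IsCompact K) {r : ℝ}
    (hr : 0 < r) (har : ∀ x ∈ K, r < ‖a x‖) :
    ∃ q : 𝓢(E, ℂ), (∀ x ∈ K, a x * q x = 1) ∧ ∀ x, ‖q x‖ ≤ r⁻¹ := by
  obtain ⟨χ, hχc, hχV, hχ1, hχ⟩ :=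
    exists_schwartz_cutoff hK (isOpen_lt continuous_const ha.continuous.norm) har
  have ha₀ : ∀ x ∈ tsupport χ, a x ≠ 0 := fun x hx => norm_pos_iff.1 (hr.trans (hχV hx))
  have hs : ContDiff ℝ ∞ fun x => χ x * (a x)⁻¹ := by
    refine contDiff_iff_contDiffAt.2 fun x => ?_
    by_cases hx : x ∈ tsupport χ
    · exact (χ.smooth ⊤).contDiffAt.mul (ha.contDiffAt.inv (ha₀ x hx))
    · refine (contDiffAt_const (c := (0 : ℂ))).congr_of_eventuallyEq ?_
      filter_upwards [notMem_tsupport_iff_eventuallyEq.1 hx] with y hy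
      simp [hy]
  have hc : HasCompactSupport fun x => χ x * (a x)⁻¹ := hχc.mul_right
  refine ⟨hc.toSchwartzMap hs, fun x hx => ?_, fun x => ?_⟩
  · have hχx := hχ1.self_of_nhdsSet x hx
    have hxK : x ∈ tsupport χ := subset_tsupport _ (by simp [hχx])
    simp [hχx, ha₀ x hxK]
  · rw [HasCompactSupport.toSchwartzMap_toFun, norm_mul, norm_inv]
    by_cases hx : x ∈ tsupport χ
    · exact (mul_le_of_le_one_left (by positivity) (hχ x)).trans (inv_anti₀ hr (hχV hx).le)
    · simp [image_eq_zero_of_notMem_tsupport hx, hr.le]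

/-- A test function `u` supported where `‖a‖ > R` is `a ^ n` times `a⁻ⁿ u`, and `a⁻ⁿ u` decays
faster than `R⁻ⁿ`, so `U u = 0`. -/
theorem norm_le_of_mem_dsupport_of_norm_smulLeftCLM_pow_apply_le (ha : a.HasTemperateGrowth)
    {Q : Seminorm ℝ 𝓢(E, ℂ)} (hQ : Continuous Q) {N : ℕ} {C R : ℝ} (hC : 0 ≤ C) (hR : 0 ≤ R)
    (hU : ∀ n : ℕ, 1 ≤ n → ∀ φ : 𝓢(E, ℂ),
      ‖TemperedDistribution.smulLeftCLM F (a ^ n) U φ‖ ≤ C * (n : ℝ) ^ N * R ^ n * Q φ)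
    {x : E} (hx : x ∈ dsupport U) : ‖a x‖ ≤ R := by
  by_contra! hlt
  obtain ⟨R₂, hR₂, hR₂x⟩ := exists_between hlt
  obtain ⟨R₁, hR₁, hR₁₂⟩ := exists_between hR₂
  have hR₁0 : 0 < R₁ := hR.trans_lt hR₁
  refine (mem_dsupport_iff_not_isVanishingOn x).1 hx {y | R₂ < ‖a y‖} hR₂x
    (isOpen_lt continuous_const ha.1.continuous.norm)
    (isVanishingOn_of_hasCompactSupport fun u huc hu => ?_)
  obtain ⟨q, haq, hq⟩ := exists_schwartz_mul_eq_one ha.1 huc (hR₁0.trans hR₁₂) hu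
  obtain ⟨D, k, l, -, hD⟩ := exists_pow_smulLeftCLM_le hQ q hq (inv_strictAnti₀ hR₁0 hR₁₂)
  have hu_eq : ∀ n, smulLeftCLM ℂ (a ^ n) (smulLeftCLM ℂ ((q : E → ℂ) ^ n) u) = u := fun n => by
    ext y
    rw [coe_smulLeftCLM (ha.pow n), coe_smulLeftCLM (q.hasTemperateGrowth.pow n)]
    by_cases hy : y ∈ tsupport u
    · simp [← mul_assoc, ← mul_pow, haq y hy]
    · simp [image_eq_zero_of_notMem_tsupport hy]
  have hbound : ∀ n : ℕ, 1 ≤ n →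
      ‖U u‖ ≤ C * D * schwartzNorm k l u * ((n : ℝ) ^ N * (R / R₁) ^ n) := fun n hn => by
    calc ‖U u‖ = ‖TemperedDistribution.smulLeftCLM F (a ^ n) U
          (smulLeftCLM ℂ ((q : E → ℂ) ^ n) u)‖ := by
          rw [TemperedDistribution.smulLeftCLM_apply_apply, hu_eq]
      _ ≤ C * (n : ℝ) ^ N * R ^ n * Q (smulLeftCLM ℂ ((q : E → ℂ) ^ n) u) := hU n hn _
      _ ≤ C * (n : ℝ) ^ N * R ^ n * (D * R₁⁻¹ ^ n * schwartzNorm k l u) := by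
          gcongr
          exact hD n u
      _ = C * D * schwartzNorm k l u * ((n : ℝ) ^ N * (R / R₁) ^ n) := by
          rw [div_eq_mul_inv, mul_pow]
          ring
  have hratio : |R / R₁| < 1 := by
    rwa [abs_of_nonneg (by positivity), div_lt_one hR₁0]
  have hlim : Tendsto (fun n : ℕ => C * D * schwartzNorm k l u * ((n : ℝ) ^ N * (R / R₁) ^ n))
      atTop (𝓝 0) := by
    simpa using (tendsto_pow_const_mul_const_pow_of_abs_lt_one N hratio).const_mul _
  exact norm_le_zero_iff.1 (ge_of_tendsto hlim (eventually_atTop.2 ⟨1, hbound⟩))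

end Powers

section Multiplier

variable {d : ℕ}

/-- The inverse of `fourierS`. -/
def fourierSInv (d : ℕ) : 𝓢(Rd d, ℂ) →L[ℂ] 𝓢(Rd d, ℂ) :=
  (((2 * Real.pi) ^ (-(d : ℝ) / 2) : ℝ) : ℂ)⁻¹ •
    (FourierTransform.fourierInvCLM ℂ 𝓢(Rd d, ℂ)).comp
      (compCLMOfContinuousLinearEquiv ℂ (dilation d).symm)

theorem ofReal_two_pi_rpow_ne_zero (s : ℝ) : (((2 * Real.pi) ^ s : ℝ) : ℂ) ≠ 0 :=
  Complex.ofReal_ne_zero.2 (Real.rpow_pos_of_pos Real.two_pi_pos s).ne'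

theorem fourierS_fourierSInv (φ : 𝓢(Rd d, ℂ)) : fourierS d (fourierSInv d φ) = φ := by
  ext x
  simp [fourierS, fourierSInv, inv_mul_cancel_left₀ (ofReal_two_pi_rpow_ne_zero _)]

theorem fourierSInv_fourierS (φ : 𝓢(Rd d, ℂ)) : fourierSInv d (fourierS d φ) = φ := by
  have hdil : compCLMOfContinuousLinearEquiv ℂ (dilation d).symm
      (compCLMOfContinuousLinearEquiv ℂ (dilation d) (𝓕 φ)) = 𝓕 φ := by
    ext x
    simp
  ext ξ
  simp [fourierS, fourierSInv, hdil, inv_mul_cancel_left₀ (ofReal_two_pi_rpow_ne_zero _)]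

/-- The symbol `i ξ_j` of `∂_j`. -/
def coordSymbol (j : Fin d) : Rd d → ℂ :=
  fun ξ => Complex.I * ((ξ j : ℝ) : ℂ)

theorem hasTemperateGrowth_coordSymbol (j : Fin d) : (coordSymbol j).HasTemperateGrowth :=
  (Function.HasTemperateGrowth.const Complex.I).mul
    (Complex.ofRealCLM.comp (EuclideanSpace.proj (𝕜 := ℝ) j)).hasTemperateGrowth

theorem evalI_eq_sum (P : MvPolynomial (Fin d) ℂ) :
    evalI P = fun ξ => ∑ m ∈ P.support, (P.coeff m • ∏ j, coordSymbol j ^ m j) ξ := by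
  ext ξ
  simp [evalI, MvPolynomial.eval_eq', coordSymbol]

theorem hasTemperateGrowth_evalI (P : MvPolynomial (Fin d) ℂ) : (evalI P).HasTemperateGrowth := by
  induction P using MvPolynomial.induction_on with
  | C c =>
    have hC : evalI (MvPolynomial.C c : MvPolynomial (Fin d) ℂ) = fun _ => c := by
      ext ξ
      simp [evalI]
    exact hC ▸ Function.HasTemperateGrowth.const c
  | add P Q hP hQ =>
    have hadd : evalI (P + Q) = evalI P + evalI Q := by
      ext ξ
      simp [evalI]
    exact hadd ▸ hP.add hQ
  | mul_X P j hP =>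
    have hmul : evalI (P * MvPolynomial.X j) = evalI P * coordSymbol j := by
      ext ξ
      simp [evalI, coordSymbol]
    exact hmul ▸ hP.mul (hasTemperateGrowth_coordSymbol j)

theorem fourierInv_lineDerivOp_single (j : Fin d) (ψ : 𝓢(Rd d, ℂ)) :
    𝓕⁻ (∂_{EuclideanSpace.single j (1 : ℝ)} ψ) =
      -(2 * Real.pi) • smulLeftCLM ℂ (coordSymbol j) (𝓕⁻ ψ) := by
  have hinner : (fun ξ : Rd d => inner ℝ ξ (EuclideanSpace.single j (1 : ℝ))) = fun ξ => ξ j := by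
    ext ξ
    simp [EuclideanSpace.inner_single_right]
  have hproj : (fun ξ : Rd d => ξ j).HasTemperateGrowth :=
    (EuclideanSpace.proj (𝕜 := ℝ) j).hasTemperateGrowth
  ext ξ
  simp only [fourierInv_lineDerivOp_eq, hinner, smul_apply, smulLeftCLM_apply_apply hproj,
    smulLeftCLM_apply_apply (hasTemperateGrowth_coordSymbol j), coordSymbol, smul_eq_mul,
    Complex.real_smul]
  push_cast
  ring

theorem smulLeftCLM_coordSymbol_fourierSInv (j : Fin d) (φ : 𝓢(Rd d, ℂ)) :
    smulLeftCLM ℂ (coordSymbol j) (fourierSInv d φ) =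
      fourierSInv d (-∂_{EuclideanSpace.single j (1 : ℝ)} φ) := by
  have hdil : (dilation d).symm (EuclideanSpace.single j 1) =
      (2 * Real.pi) • EuclideanSpace.single j 1 := by
    rw [ContinuousLinearEquiv.symm_apply_eq]
    exact (inv_smul_smul₀ Real.two_pi_pos.ne' _).symm
  have hderiv := lineDerivOp_compCLMOfContinuousLinearEquiv ℂ (EuclideanSpace.single j (1 : ℝ))
    (dilation d).symm φ
  rw [hdil, lineDerivOp_left_smul, ContinuousLinearMap.map_smul_of_tower] at hderiv
  have hfourier := congrArg 𝓕⁻ hderiv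
  rw [fourierInv_lineDerivOp_single, FourierTransform.fourierInv_smul, neg_smul,
    ← smul_neg] at hfourier
  simp [fourierSInv, ← smul_right_injective _ Real.two_pi_pos.ne' hfourier]

/-- The Fourier multiplier `ℱ⁻¹ σ ℱ` on tempered distributions. -/
def fourierMultiplier (σ : Rd d → ℂ) (T : 𝓢'(Rd d, ℂ)) : 𝓢'(Rd d, ℂ) :=
  PointwiseConvergenceCLM.precomp ℂ (fourierSInv d)
    (TemperedDistribution.smulLeftCLM ℂ σ (fourierT T))

theorem fourierMultiplier_apply (σ : Rd d → ℂ) (T : 𝓢'(Rd d, ℂ)) (φ : 𝓢(Rd d, ℂ)) :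
    fourierMultiplier σ T φ = fourierT T (smulLeftCLM ℂ σ (fourierSInv d φ)) :=
  TemperedDistribution.smulLeftCLM_apply_apply σ (fourierT T) (fourierSInv d φ)

theorem fourierMultiplier_one (T : 𝓢'(Rd d, ℂ)) : fourierMultiplier 1 T = T := by
  ext φ
  rw [fourierMultiplier_apply, show (1 : Rd d → ℂ) = fun _ => 1 from rfl, smulLeftCLM_const,
    one_smul, ContinuousLinearMap.id_apply, fourierT_apply, fourierS_fourierSInv]

theorem lineDerivOp_fourierMultiplier {σ : Rd d → ℂ} (hσ : σ.HasTemperateGrowth) (j : Fin d)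
    (T : 𝓢'(Rd d, ℂ)) :
    ∂_{EuclideanSpace.single j (1 : ℝ)} (fourierMultiplier σ T) =
      fourierMultiplier (σ * coordSymbol j) T := by
  ext φ
  rw [TemperedDistribution.lineDerivOp_apply_apply, fourierMultiplier_apply,
    fourierMultiplier_apply, ← smulLeftCLM_coordSymbol_fourierSInv,
    smulLeftCLM_smulLeftCLM_apply hσ (hasTemperateGrowth_coordSymbol j)]

theorem fourierMultiplier_smul {σ : Rd d → ℂ} (hσ : σ.HasTemperateGrowth) (c : ℂ)
    (T : 𝓢'(Rd d, ℂ)) : fourierMultiplier (c • σ) T = c • fourierMultiplier σ T := by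
  rw [fourierMultiplier, TemperedDistribution.smulLeftCLM_smul hσ]
  rfl

theorem fourierMultiplier_sum {ι : Type*} {s : Finset ι} {σ : ι → Rd d → ℂ}
    (hσ : ∀ i ∈ s, (σ i).HasTemperateGrowth) (T : 𝓢'(Rd d, ℂ)) :
    fourierMultiplier (fun ξ => ∑ i ∈ s, σ i ξ) T = ∑ i ∈ s, fourierMultiplier (σ i) T := by
  rw [fourierMultiplier, TemperedDistribution.smulLeftCLM_sum hσ, sum_apply, map_sum]
  rfl

end Multiplier

section Represents

variable {d : ℕ} {g : Rd d → ℂ} {U : 𝓢'(Rd d, ℂ)}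

theorem integrable_mul_of_hasCompactSupport (hg : Continuous g) {φ : 𝓢(Rd d, ℂ)}
    (hφ : HasCompactSupport φ) : Integrable fun x => g x * φ x :=
  (hg.mul φ.continuous).integrable_of_hasCompactSupport hφ.mul_left

theorem contDiff_partialDeriv (hg : ContDiff ℝ ∞ g) (j : Fin d) :
    ContDiff ℝ ∞ (partialDeriv j g) :=
  (hg.fderiv_right (m := ∞) (by simp)).clm_apply contDiff_const

theorem Represents.lineDerivOp (h : Represents g U) (hg : ContDiff ℝ ∞ g) (j : Fin d) :
    Represents (partialDeriv j g) (∂_{EuclideanSpace.single j (1 : ℝ)} U) := by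
  intro φ hφ
  let v : Rd d := EuclideanSpace.single j (1 : ℝ)
  have hφv : HasCompactSupport (∂_{v} φ : 𝓢(Rd d, ℂ)) :=
    hφ.of_isClosed_subset isClosed_closure (tsupport_fderiv_apply_subset ℝ v)
  rw [TemperedDistribution.lineDerivOp_apply_apply, map_neg, h _ hφv]
  have hparts := integral_mul_fderiv_eq_neg_fderiv_mul_of_integrable (μ := volume) (v := v)
    (integrable_mul_of_hasCompactSupport (contDiff_partialDeriv hg j).continuous hφ)
    (integrable_mul_of_hasCompactSupport hg.continuous hφv)
    (integrable_mul_of_hasCompactSupport hg.continuous hφ)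
    (fun x _ => hg.differentiable (by simp) x) (fun x _ => φ.differentiable x)
  exact neg_eq_iff_eq_neg.2 hparts

theorem Represents.const_mul (h : Represents g U) (c : ℂ) :
    Represents (fun x => c * g x) (c • U) := by
  intro φ hφ
  simp only [mul_assoc, integral_const_mul, ← h φ hφ]
  rfl

theorem Represents.sum {ι : Type*} {s : Finset ι} {G : ι → Rd d → ℂ} {V : ι → 𝓢'(Rd d, ℂ)}
    (hG : ∀ i ∈ s, Continuous (G i)) (h : ∀ i ∈ s, Represents (G i) (V i)) :
    Represents (fun x => ∑ i ∈ s, G i x) (∑ i ∈ s, V i) := by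
  intro φ hφ
  simp only [Finset.sum_mul]
  rw [integral_finsetSum _ fun i hi => integrable_mul_of_hasCompactSupport (hG i hi) hφ, sum_apply]
  exact Finset.sum_congr rfl fun i hi => h i hi φ hφ

end Represents

section Symbol

variable {d : ℕ} {T : 𝓢'(Rd d, ℂ)} {σ g : Rd d → ℂ}

/-- The distribution `ℱ⁻¹ σ ℱ T` is the smooth function `g`: this relates a differential operator
applied to a function to its symbol. -/
structure HasSymbol (T : 𝓢'(Rd d, ℂ)) (σ g : Rd d → ℂ) : Prop where
  contDiff : ContDiff ℝ ∞ g
  hasTemperateGrowth : σ.HasTemperateGrowth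
  represents : Represents g (fourierMultiplier σ T)

namespace HasSymbol

theorem of_represents (hg : ContDiff ℝ ∞ g) (hT : Represents g T) : HasSymbol T 1 g :=
  ⟨hg, Function.HasTemperateGrowth.const 1, by rwa [fourierMultiplier_one]⟩

theorem map_partialDeriv (h : HasSymbol T σ g) (j : Fin d) :
    HasSymbol T (σ * coordSymbol j) (partialDeriv j g) :=
  ⟨contDiff_partialDeriv h.contDiff j, h.hasTemperateGrowth.mul (hasTemperateGrowth_coordSymbol j),
    lineDerivOp_fourierMultiplier h.hasTemperateGrowth j T ▸
      h.represents.lineDerivOp h.contDiff j⟩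

theorem map_iterate_partialDeriv (h : HasSymbol T σ g) (j : Fin d) (k : ℕ) :
    HasSymbol T (σ * coordSymbol j ^ k) ((partialDeriv j)^[k] g) := by
  induction k with
  | zero => simpa using h
  | succ k ih =>
    rw [Function.iterate_succ_apply', pow_succ, ← mul_assoc]
    exact ih.map_partialDeriv j

theorem map_foldr_partialDeriv (h : HasSymbol T σ g) (m : Fin d →₀ ℕ) (L : List (Fin d)) :
    HasSymbol T (σ * (L.map fun j => coordSymbol j ^ m j).prod)
      (L.foldr (fun j f => (partialDeriv j)^[m j] f) g) := by
  induction L with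
  | nil => simpa using h
  | cons j L ih =>
    rw [List.map_cons, List.prod_cons, List.foldr_cons, mul_left_comm, mul_comm]
    exact ih.map_iterate_partialDeriv j (m j)

theorem map_multiDeriv (h : HasSymbol T σ g) (m : Fin d →₀ ℕ) :
    HasSymbol T (σ * ∏ j, coordSymbol j ^ m j) (multiDeriv m g) := by
  rw [← List.prod_ofFn, List.ofFn_eq_map]
  exact h.map_foldr_partialDeriv m (List.finRange d)

theorem const_mul (h : HasSymbol T σ g) (c : ℂ) : HasSymbol T (c • σ) (fun x => c * g x) :=
  ⟨contDiff_const.mul h.contDiff, (Function.HasTemperateGrowth.const c).mul h.hasTemperateGrowth,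
    fourierMultiplier_smul h.hasTemperateGrowth c T ▸ h.represents.const_mul c⟩

theorem sum {ι : Type*} {s : Finset ι} {τ G : ι → Rd d → ℂ}
    (h : ∀ i ∈ s, HasSymbol T (τ i) (G i)) :
    HasSymbol T (fun ξ => ∑ i ∈ s, τ i ξ) (fun x => ∑ i ∈ s, G i x) :=
  ⟨ContDiff.sum fun i hi => (h i hi).contDiff,
    Function.HasTemperateGrowth.sum fun i hi => (h i hi).hasTemperateGrowth,
    fourierMultiplier_sum (fun i hi => (h i hi).hasTemperateGrowth) T ▸
      Represents.sum (fun i hi => (h i hi).contDiff.continuous) fun i hi => (h i hi).represents⟩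

theorem map_diffOp (h : HasSymbol T σ g) (P : MvPolynomial (Fin d) ℂ) :
    HasSymbol T (σ * evalI P) (diffOp P g) := by
  have hsymbol : σ * evalI P =
      fun ξ => ∑ m ∈ P.support, (P.coeff m • (σ * ∏ j, coordSymbol j ^ m j)) ξ := by
    ext ξ
    simp [evalI_eq_sum, Finset.mul_sum, mul_left_comm]
  rw [hsymbol]
  exact sum fun m _ => (h.map_multiDeriv m).const_mul (P.coeff m)

theorem map_iterate_diffOp (h : HasSymbol T 1 g) (P : MvPolynomial (Fin d) ℂ) (n : ℕ) :
    HasSymbol T (evalI P ^ n) ((diffOp P)^[n] g) := by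
  induction n with
  | zero => exact h
  | succ n ih =>
    rw [Function.iterate_succ_apply', pow_succ]
    exact ih.map_diffOp P

end HasSymbol

end Symbol

section FourierEstimate

theorem norm_iteratedFDeriv_fourierInv_le {V E : Type*} [NormedAddCommGroup V]
    [InnerProductSpace ℝ V] [FiniteDimensional ℝ V] [MeasurableSpace V] [BorelSpace V]
    [NormedAddCommGroup E] [NormedSpace ℂ E] (φ : 𝓢(V, E)) (j : ℕ) (ξ : V) :
    ‖iteratedFDeriv ℝ j (𝓕⁻ φ : 𝓢(V, E)) ξ‖ ≤ ∫ v, ‖(2 * Real.pi) • v‖ ^ j * ‖φ v‖ := by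
  have hneg : ((𝓕⁻ φ : 𝓢(V, E)) : V → E) = 𝓕 (φ : V → E) ∘ LinearIsometryEquiv.neg ℝ :=
    funext fun w => by
      rw [fourierInv_coe, Real.fourierInv_eq_fourier_neg]
      rfl
  have hinner : 2 * Real.pi * ‖(innerSL ℝ : V →L[ℝ] V →L[ℝ] ℝ)‖ ≤ 2 * Real.pi :=
    mul_le_of_le_one_right Real.two_pi_pos.le (norm_innerSL_le ℝ)
  have hscale : ∀ v : V, ‖(2 * Real.pi) • v‖ ^ j = (2 * Real.pi) ^ j * ‖v‖ ^ j := fun v => by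
    rw [norm_smul, Real.norm_of_nonneg Real.two_pi_pos.le, mul_pow]
  simp only [hscale, mul_assoc ((2 * Real.pi) ^ j)]
  rw [hneg, LinearIsometryEquiv.norm_iteratedFDeriv_comp_right,
    Real.iteratedFDeriv_fourier (N := ⊤) (fun n _ => φ.integrable_pow_mul volume n)
      φ.continuous.aestronglyMeasurable le_top]
  refine (VectorFourier.norm_fourierIntegral_le_integral_norm _ _ _ _ _).trans ?_
  refine integral_mono_of_nonneg (.of_forall fun _ => norm_nonneg _)
    ((φ.integrable_pow_mul volume j).const_mul _) (.of_forall fun v => ?_)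
  refine (VectorFourier.norm_fourierPowSMulRight_le _ _ _ _).trans ?_
  rw [mul_assoc]
  exact mul_le_mul_of_nonneg_right (pow_le_pow_left₀ (by positivity) hinner j) (by positivity)

variable {d : ℕ}

theorem norm_iteratedFDeriv_fourierSInv_le (φ : 𝓢(Rd d, ℂ)) (j : ℕ) (ξ : Rd d) :
    ‖iteratedFDeriv ℝ j (fourierSInv d φ) ξ‖ ≤
      (2 * Real.pi) ^ (-(d : ℝ) / 2) * ∫ y, ‖y‖ ^ j * ‖φ y‖ := by
  let c : ℝ := (2 * Real.pi) ^ (-(d : ℝ) / 2)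
  have hc : 0 < c := Real.rpow_pos_of_pos Real.two_pi_pos _
  have hcc : c⁻¹ * ((2 * Real.pi) ^ d)⁻¹ = c := by
    rw [inv_mul_eq_iff_eq_mul₀ hc.ne', ← Real.rpow_add Real.two_pi_pos, ← Real.rpow_natCast,
      ← Real.rpow_neg Real.two_pi_pos.le]
    ring_nf
  let ψ : 𝓢(Rd d, ℂ) := (c : ℂ)⁻¹ • compCLMOfContinuousLinearEquiv ℂ (dilation d).symm φ
  have hψ : ∀ v, ‖ψ v‖ = c⁻¹ * ‖φ ((2 * Real.pi) • v)‖ := by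
    intro v
    have hdil : (dilation d).symm v = (2 * Real.pi) • v := by
      rw [ContinuousLinearEquiv.symm_apply_eq]
      exact (inv_smul_smul₀ Real.two_pi_pos.ne' _).symm
    simp [ψ, hdil, abs_of_pos hc]
  have hinv : fourierSInv d φ = 𝓕⁻ ψ := by
    simp [fourierSInv, ψ, FourierTransform.fourierInv_smul, c]
  calc ‖iteratedFDeriv ℝ j (fourierSInv d φ) ξ‖
      ≤ ∫ v, ‖(2 * Real.pi) • v‖ ^ j * ‖ψ v‖ := hinv ▸ norm_iteratedFDeriv_fourierInv_le ψ j ξ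
    _ = c⁻¹ * ∫ v, ‖(2 * Real.pi) • v‖ ^ j * ‖φ ((2 * Real.pi) • v)‖ := by
        simp only [hψ, mul_left_comm, integral_const_mul]
    _ = c⁻¹ * (((2 * Real.pi) ^ d)⁻¹ * ∫ y, ‖y‖ ^ j * ‖φ y‖) := by
        rw [Measure.integral_comp_smul volume fun y => ‖y‖ ^ j * ‖φ y‖, finrank_euclideanSpace_fin,
          abs_of_pos (inv_pos.2 (pow_pos Real.two_pi_pos d)), smul_eq_mul]
    _ = c * ∫ y, ‖y‖ ^ j * ‖φ y‖ := by rw [← mul_assoc, hcc]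

theorem schwartzNorm_fourierSInv_le {φ : 𝓢(Rd d, ℂ)} {r : ℝ} (hr : 1 ≤ r)
    (hφr : ∀ y, φ y ≠ 0 → ‖y‖ ≤ r) (hφ : ∫ y, ‖φ y‖ = 1) (l : ℕ) :
    schwartzNorm 0 l (fourierSInv d φ) ≤ (2 * Real.pi) ^ (-(d : ℝ) / 2) * r ^ l := by
  refine schwartzNorm_le_of_forall fun i hi j hj ξ => ?_
  have hmoment : ∫ y, ‖y‖ ^ j * ‖φ y‖ ≤ r ^ l := by
    calc ∫ y, ‖y‖ ^ j * ‖φ y‖ ≤ ∫ y, r ^ l * ‖φ y‖ := by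
          refine integral_mono (φ.integrable_pow_mul volume j) (φ.integrable.norm.const_mul _)
            fun y => ?_
          rcases eq_or_ne (φ y) 0 with hy | hy
          · simp [hy]
          · beta_reduce
            gcongr
            exact (pow_le_pow_left₀ (norm_nonneg y) (hφr y hy) j).trans (pow_le_pow_right₀ hr hj)
      _ = r ^ l := by rw [integral_const_mul, hφ, mul_one]
  rw [Nat.le_zero.1 hi, pow_zero, one_mul]
  exact (norm_iteratedFDeriv_fourierSInv_le φ j ξ).trans (by gcongr)

end FourierEstimate

section Mollification

variable {E : Type*} [NormedAddCommGroup E] [InnerProductSpace ℝ E] [FiniteDimensional ℝ E]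
  [MeasurableSpace E] [BorelSpace E]

theorem exists_schwartz_mollifier (x : E) {δ : ℝ} (hδ : 0 < δ) :
    ∃ φ : 𝓢(E, ℂ), HasCompactSupport φ ∧ (∀ y, φ y ≠ 0 → dist y x < δ) ∧
      ∫ y, φ y = 1 ∧ ∫ y, ‖φ y‖ = 1 := by
  let b : ContDiffBump x := ⟨δ / 2, δ, half_pos hδ, half_lt_self hδ⟩
  have hcompact : HasCompactSupport fun y => (b.normed volume y : ℂ) :=
    b.hasCompactSupport_normed.comp_left Complex.ofReal_zero
  refine ⟨hcompact.toSchwartzMap (Complex.ofRealCLM.contDiff.comp b.contDiff_normed), hcompact,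
    fun y hy => ?_, ?_, ?_⟩
  · have hsupp : y ∈ Function.support (b.normed volume) :=
      Complex.ofReal_ne_zero.1 hy
    rwa [b.support_normed_eq] at hsupp
  · change ∫ y, (b.normed volume y : ℂ) = 1
    rw [integral_complex_ofReal, b.integral_normed, Complex.ofReal_one]
  · change ∫ y, ‖(b.normed volume y : ℂ)‖ = 1
    simp only [Complex.norm_real, Real.norm_of_nonneg (b.nonneg_normed _), b.integral_normed]

theorem norm_le_of_forall_norm_integral_le {g : E → ℂ} (hg : Continuous g) {x : E} {M : ℝ}
    (h : ∀ φ : 𝓢(E, ℂ), HasCompactSupport φ → (∀ y, φ y ≠ 0 → ‖y‖ ≤ 1 + ‖x‖) →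
      ∫ y, ‖φ y‖ = 1 → ‖∫ y, g y * φ y‖ ≤ M) : ‖g x‖ ≤ M := by
  refine le_of_forall_pos_le_add fun ε hε => ?_
  obtain ⟨δ, hδ, hgδ⟩ := Metric.continuousAt_iff.1 hg.continuousAt ε hε
  obtain ⟨φ, hφc, hφx, hφ, hφn⟩ := exists_schwartz_mollifier x (lt_min hδ one_pos)
  have hmean : ‖∫ y, g y * φ y‖ ≤ M := by
    refine h φ hφc (fun y hy => ?_) hφn
    have hy1 : ‖y - x‖ < 1 := (dist_eq_norm y x).symm.trans_lt
      ((hφx y hy).trans_le (min_le_right _ _))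
    linarith [norm_le_norm_add_norm_sub' y x]
  have hdiff : ‖g x - ∫ y, g y * φ y‖ ≤ ε := by
    calc ‖g x - ∫ y, g y * φ y‖ = ‖∫ y, (g x - g y) * φ y‖ := by
          have hgφ : Integrable fun y => g y * φ y :=
            (hg.mul φ.continuous).integrable_of_hasCompactSupport hφc.mul_left
          simp only [sub_mul]
          rw [integral_sub (φ.integrable.const_mul _) hgφ, integral_const_mul, hφ, mul_one]
      _ ≤ ∫ y, ε * ‖φ y‖ := by
          refine norm_integral_le_of_norm_le (φ.integrable.norm.const_mul ε)
            (.of_forall fun y => ?_)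
          rcases eq_or_ne (φ y) 0 with hy | hy
          · simp [hy]
          · rw [norm_mul, ← dist_eq_norm, dist_comm]
            gcongr
            exact (hgδ ((hφx y hy).trans_le (min_le_left _ _))).le
      _ = ε := by rw [integral_const_mul, hφn, mul_one]
  linarith [norm_le_norm_add_norm_sub' (g x) (∫ y, g y * φ y)]

end Mollification

section PolynomialGrowth

theorem exists_norm_integral_mul_le {E : Type*} [NormedAddCommGroup E] [NormedSpace ℝ E]
    [MeasurableSpace E] (μ : Measure E) [μ.HasTemperateGrowth] (N : ℕ) :
    ∃ (A : ℝ) (k : ℕ), 0 ≤ A ∧ ∀ (g : E → ℂ) (M : ℝ), (∀ x, ‖g x‖ ≤ M * (1 + ‖x‖) ^ N) →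
      ∀ φ : 𝓢(E, ℂ), ‖∫ x, g x * φ x ∂μ‖ ≤ M * (A * schwartzNorm k 0 φ) := by
  let r := μ.integrablePower
  have hint : Integrable (fun x : E => (1 + ‖x‖) ^ (-(r : ℝ))) μ :=
    Measure.integrable_pow_neg_integrablePower μ
  refine ⟨2 ^ (N + r) * ∫ x, (1 + ‖x‖) ^ (-(r : ℝ)) ∂μ, N + r,
    mul_nonneg (by positivity) (integral_nonneg fun x => by positivity), fun g M hg φ => ?_⟩
  have hM : 0 ≤ M := by simpa using (norm_nonneg _).trans (hg 0)
  have hdecay : ∀ x, (1 + ‖x‖) ^ (N + r) * ‖φ x‖ ≤ 2 ^ (N + r) * schwartzNorm (N + r) 0 φ := by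
    intro x
    rw [← norm_iteratedFDeriv_zero (𝕜 := ℝ) (f := φ)]
    exact one_add_le_sup_seminorm_apply (𝕜 := ℝ) (m := (N + r, 0)) le_rfl le_rfl φ x
  have hbound : ∀ x, ‖g x * φ x‖ ≤
      M * (2 ^ (N + r) * schwartzNorm (N + r) 0 φ) * (1 + ‖x‖) ^ (-(r : ℝ)) := by
    intro x
    have hx : (0 : ℝ) < 1 + ‖x‖ := by positivity
    rw [norm_mul, Real.rpow_neg hx.le, Real.rpow_natCast, ← div_eq_mul_inv,
      le_div_iff₀ (by positivity)]
    calc ‖g x‖ * ‖φ x‖ * (1 + ‖x‖) ^ r ≤ M * (1 + ‖x‖) ^ N * ‖φ x‖ * (1 + ‖x‖) ^ r := by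
          gcongr
          exact hg x
      _ = M * ((1 + ‖x‖) ^ (N + r) * ‖φ x‖) := by ring
      _ ≤ M * (2 ^ (N + r) * schwartzNorm (N + r) 0 φ) :=
        mul_le_mul_of_nonneg_left (hdecay x) hM
  refine (norm_integral_le_of_norm_le (hint.const_mul _) (.of_forall hbound)).trans_eq ?_
  rw [integral_const_mul]
  ring

theorem Represents.norm_apply_le {d : ℕ} {g : Rd d → ℂ} {U : 𝓢'(Rd d, ℂ)} (h : Represents g U)
    {Q : 𝓢(Rd d, ℂ) → ℝ} (hQ : Continuous Q) (hg : ∀ φ, ‖∫ x, g x * φ x‖ ≤ Q φ)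
    (φ : 𝓢(Rd d, ℂ)) : ‖U φ‖ ≤ Q φ := by
  have hclosed : IsClosed {u : 𝓢(Rd d, ℂ) | ‖U u‖ ≤ Q u} := isClosed_le U.continuous.norm hQ
  refine hclosed.closure_subset_iff.2 (fun u hu => ?_) (mem_closure_hasCompactSupport φ)
  rw [mem_ofPred_eq, h u hu.1]
  exact hg u

end PolynomialGrowth

section GrowthExponent

variable {d : ℕ} {f : Rd d → ℂ} {T : 𝓢'(Rd d, ℂ)}

theorem continuous_evalI (P : MvPolynomial (Fin d) ℂ) : Continuous (evalI P) :=
  (hasTemperateGrowth_evalI P).1.continuous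

theorem enorm_evalI_le_supOn (P : MvPolynomial (Fin d) ℂ) {S : Set (Rd d)} {ξ : Rd d}
    (hξ : ξ ∈ S) : ‖evalI P ξ‖ₑ ≤ supOn P S :=
  le_iSup₂ (f := fun ξ _ => ‖evalI P ξ‖ₑ) ξ hξ

theorem supOn_le_coe_iff {P : MvPolynomial (Fin d) ℂ} {S : Set (Rd d)} {R : ℝ≥0} :
    supOn P S ≤ R ↔ ∀ ξ ∈ S, ‖evalI P ξ‖ ≤ R := by
  simp only [supOn, iSup₂_le_iff, enorm_le_coe, ← NNReal.coe_le_coe, coe_nnnorm]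

theorem supOn_ne_top (P : MvPolynomial (Fin d) ℂ) {S : Set (Rd d)} (hS : IsCompact S) :
    supOn P S ≠ ⊤ := by
  obtain ⟨C, hC⟩ := hS.exists_bound_of_continuousOn (continuous_evalI P).continuousOn
  have hle : supOn P S ≤ C.toNNReal :=
    supOn_le_coe_iff.2 fun ξ hξ => (hC ξ hξ).trans (Real.le_coe_toNNReal C)
  exact ne_top_of_le_ne_top ENNReal.coe_ne_top hle

theorem growthBound_of_supportRadius_lt (hf : ContDiff ℝ ∞ f) (hT : Represents f T)
    (hsupp : IsCompact (Distribution.dsupport (fourierT T))) {P : MvPolynomial (Fin d) ℂ} {R : ℝ≥0}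
    (hR : supportRadius P (fourierT T) < R) : GrowthBound P f R := by
  have hR₀ : 0 < (R : ℝ) := by exact_mod_cast pos_of_gt hR
  have hPR : ∀ ξ ∈ Distribution.dsupport (fourierT T), ‖evalI P ξ‖ < R := fun ξ hξ => by
    exact_mod_cast enorm_lt_coe.1 ((enorm_evalI_le_supOn P hξ).trans_lt hR)
  obtain ⟨C, l, hC, hpow⟩ :=
    exists_norm_smulLeftCLM_pow_apply_le hsupp (hasTemperateGrowth_evalI P) hR₀ hPR
  let c : ℝ := (2 * Real.pi) ^ (-(d : ℝ) / 2)
  have : 0 ≤ c := by positivity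
  refine ⟨l, C * c, by positivity, fun n hn x => ?_⟩
  have hsymbol := (HasSymbol.of_represents hf hT).map_iterate_diffOp P n
  have hmollified : ‖(diffOp P)^[n] f x‖ ≤ C * R ^ n * (c * (1 + ‖x‖) ^ l) := by
    refine norm_le_of_forall_norm_integral_le hsymbol.contDiff.continuous
      fun φ hφc hφx hφ => ?_
    rw [← hsymbol.represents φ hφc]
    refine (hpow n (fourierSInv d φ)).trans ?_
    gcongr
    exact schwartzNorm_fourierSInv_le (by simp) hφx hφ l
  calc ‖(diffOp P)^[n] f x‖ ≤ 1 * (C * R ^ n * (c * (1 + ‖x‖) ^ l)) := by rwa [one_mul]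
    _ ≤ n ^ l * (C * R ^ n * (c * (1 + ‖x‖) ^ l)) := by
        gcongr
        exact one_le_pow₀ (by exact_mod_cast hn)
    _ = C * c * n ^ l * R ^ n * (1 + ‖x‖) ^ l := by ring

theorem supportRadius_le_of_growthBound (hf : ContDiff ℝ ∞ f) (hT : Represents f T)
    {P : MvPolynomial (Fin d) ℂ} {R : ℝ≥0} (hR : GrowthBound P f R) :
    supportRadius P (fourierT T) ≤ R := by
  obtain ⟨N, C, hC, hgrowth⟩ := hR
  obtain ⟨A, k, hA, hint⟩ := exists_norm_integral_mul_le (volume : Measure (Rd d)) N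
  let Q : Seminorm ℝ 𝓢(Rd d, ℂ) :=
    (schwartzNorm k 0).comp ((fourierS d).toLinearMap.restrictScalars ℝ)
  have hQ : Continuous Q := (continuous_schwartzNorm k 0).comp (fourierS d).continuous
  refine supOn_le_coe_iff.2 fun ξ hξ =>
    norm_le_of_mem_dsupport_of_norm_smulLeftCLM_pow_apply_le (N := N)
      (hasTemperateGrowth_evalI P) hQ (mul_nonneg hC hA) R.2 (fun n hn φ => ?_) hξ
  have hsymbol := (HasSymbol.of_represents hf hT).map_iterate_diffOp P n
  calc ‖TemperedDistribution.smulLeftCLM ℂ (evalI P ^ n) (fourierT T) φ‖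
      = ‖fourierMultiplier (evalI P ^ n) T (fourierS d φ)‖ := by
        rw [fourierMultiplier_apply, fourierSInv_fourierS,
          TemperedDistribution.smulLeftCLM_apply_apply]
    _ ≤ C * n ^ N * R ^ n * (A * Q φ) :=
        hsymbol.represents.norm_apply_le (((continuous_schwartzNorm k 0).const_mul A).const_mul _)
          (hint _ _ (hgrowth n hn)) (fourierS d φ)
    _ = C * A * n ^ N * R ^ n * Q φ := by ring

theorem growthExponent_eq_supportRadius (hf : ContDiff ℝ ∞ f) (hT : Represents f T)
    (hsupp : IsCompact (Distribution.dsupport (fourierT T))) (P : MvPolynomial (Fin d) ℂ) :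
    growthExponent P f = supportRadius P (fourierT T) := by
  refine le_antisymm (le_of_forall_gt fun c hc => ?_)
    (le_iInf₂ fun R hR => supportRadius_le_of_growthBound hf hT hR)
  obtain ⟨R, hR, hRc⟩ := ENNReal.lt_iff_exists_nnreal_btwn.1 hc
  exact (iInf₂_le R (growthBound_of_supportRadius_lt hf hT hsupp hR)).trans_lt hRc

end GrowthExponent

section Determination

variable {d : ℕ} {𝒬 : Set (MvPolynomial (Fin d) ℂ)} {K : Set (Rd d)}

theorem determines_iff :
    Determines 𝒬 K ↔ ∀ ξ, (∀ P ∈ 𝒬, ‖evalI P ξ‖ₑ ≤ supOn P K) → ξ ∈ K := by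
  have hsub : K ⊆ ⋂ P ∈ 𝒬, {ξ : Rd d | ‖evalI P ξ‖ₑ ≤ supOn P K} :=
    subset_iInter₂ fun P _ _ hξ => enorm_evalI_le_supOn P hξ
  rw [Determines, subset_antisymm_iff, and_iff_right hsub]
  simp only [subset_def, mem_iInter, mem_ofPred_eq]

theorem Determines.mem_iff (h : Determines 𝒬 K) {ξ : Rd d} :
    ξ ∈ K ↔ ∀ P ∈ 𝒬, ‖evalI P ξ‖ₑ ≤ supOn P K :=
  ⟨fun hξ P _ => enorm_evalI_le_supOn P hξ, determines_iff.1 h ξ⟩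

theorem Determines.subset_iff (h : Determines 𝒬 K) {S : Set (Rd d)} :
    S ⊆ K ↔ ∀ P ∈ 𝒬, supOn P S ≤ supOn P K :=
  ⟨fun hSK _ _ => biSup_mono hSK, fun hle _ hξ =>
    h.mem_iff.2 fun P hP => (enorm_evalI_le_supOn P hξ).trans (hle P hP)⟩

theorem exists_evalI_eq_sub_norm_sq (ξ : Rd d) (M : ℝ) :
    ∃ P : MvPolynomial (Fin d) ℂ, ∀ η, evalI P η = ((M - ‖η - ξ‖ ^ 2 : ℝ) : ℂ) := by
  refine ⟨MvPolynomial.C (M : ℂ) - ∑ j, (MvPolynomial.C (-Complex.I) * MvPolynomial.X j -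
    MvPolynomial.C ((ξ j : ℝ) : ℂ)) ^ 2, fun η => ?_⟩
  simp [EuclideanSpace.norm_sq_eq, evalI, ← mul_assoc]

/-- If `r ≤ ‖η - ξ‖ ≤ C` on `K`, then `r² + C² - ‖η - ξ‖²` lies between `0` and `C²` on `K`, and
is larger at `ξ`. -/
theorem determines_univ (hK : IsCompact K) : Determines univ K := by
  refine determines_iff.2 fun ξ hle => by_contra fun hξ => ?_
  obtain ⟨r, hr, hrK⟩ := Metric.isOpen_iff.1 hK.isClosed.isOpen_compl ξ hξ
  obtain ⟨C, hC⟩ := hK.exists_bound_of_continuousOn (f := fun η => η - ξ) (by fun_prop)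
  obtain ⟨P, hP⟩ := exists_evalI_eq_sub_norm_sq ξ (r ^ 2 + C ^ 2)
  have hsup : supOn P K ≤ (C ^ 2).toNNReal := supOn_le_coe_iff.2 fun η hη => by
    have hlower : r ^ 2 ≤ ‖η - ξ‖ ^ 2 := by
      gcongr
      by_contra! hlt
      exact hrK (by rwa [Metric.mem_ball, dist_eq_norm]) hη
    have hupper : ‖η - ξ‖ ^ 2 ≤ C ^ 2 := by
      gcongr
      exact hC η hη
    rw [hP, Complex.norm_real, Real.coe_toNNReal _ (sq_nonneg C), Real.norm_eq_abs, abs_le]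
    constructor <;> linarith [sq_nonneg r]
  have hvalue : ‖evalI P ξ‖ = r ^ 2 + C ^ 2 := by
    rw [hP, sub_self, norm_zero, Complex.norm_real, Real.norm_of_nonneg] <;>
      simp [add_nonneg, sq_nonneg]
  have hcontra := enorm_le_coe.1 ((hle P (mem_univ P)).trans hsup)
  rw [← NNReal.coe_le_coe, coe_nnnorm, hvalue, Real.coe_toNNReal _ (sq_nonneg C)] at hcontra
  linarith [pow_pos hr 2]

end Determination

end RealPaleyWiener

end

open RealPaleyWiener in
theorem mainTheorem8_general (d : ℕ) (f : Rd d → ℂ) (hf : ContDiff ℝ ∞ f)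
    (T : 𝓢'(Rd d, ℂ)) (hT : Represents f T)
    (hsupp : IsCompact (Distribution.dsupport (fourierT T))) :
    (∀ P : MvPolynomial (Fin d) ℂ,
      growthExponent P f ≠ ⊤ ∧ growthExponent P f = supportRadius P (fourierT T)) ∧
    (∀ (K : Set (Rd d)) (𝒬 : Set (MvPolynomial (Fin d) ℂ)), Determines 𝒬 K →
      (Distribution.dsupport (fourierT T) ⊆ K ↔ ∀ P ∈ 𝒬, growthExponent P f ≤ supOn P K)) ∧
    (∀ 𝒬 : Set (MvPolynomial (Fin d) ℂ), Determines 𝒬 (Distribution.dsupport (fourierT T)) →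
      ∀ ξ : Rd d, ξ ∈ Distribution.dsupport (fourierT T) ↔
        ∀ P ∈ 𝒬, ‖evalI P ξ‖ₑ ≤ growthExponent P f) ∧
    Distribution.dsupport (fourierT T) =
      {ξ : Rd d | ∀ P : MvPolynomial (Fin d) ℂ, ‖evalI P ξ‖ₑ ≤ growthExponent P f} := by
  have hradius (P : MvPolynomial (Fin d) ℂ) :
      growthExponent P f = supOn P (Distribution.dsupport (fourierT T)) :=
    growthExponent_eq_supportRadius hf hT hsupp P
  refine ⟨fun P => ⟨?_, hradius P⟩, ?_⟩
  · rw [hradius]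
    exact supOn_ne_top P hsupp
  · simp only [hradius]
    refine ⟨fun K 𝒬 h𝒬 => h𝒬.subset_iff, fun 𝒬 h𝒬 ξ => h𝒬.mem_iff, ?_⟩
    ext ξ
    simpa using (determines_univ hsupp).mem_iff (ξ := ξ)

theorem mainTheorem8 (d : ℕ) (f : RealPaleyWiener.Rd d → ℂ) (hf : ContDiff ℝ ∞ f)
    (T : 𝓢'(RealPaleyWiener.Rd d, ℂ)) (hT : RealPaleyWiener.Represents f T)
    (hsupp : IsCompact (Distribution.dsupport (RealPaleyWiener.fourierT T))) :
    (∀ P : MvPolynomial (Fin d) ℂ,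
      RealPaleyWiener.growthExponent P f ≠ ⊤ ∧
      RealPaleyWiener.growthExponent P f =
        RealPaleyWiener.supportRadius P (RealPaleyWiener.fourierT T)) ∧
    (∀ K : Set (RealPaleyWiener.Rd d), K.Nonempty → IsCompact K →
      ∀ 𝒬 : Set (MvPolynomial (Fin d) ℂ), RealPaleyWiener.Determines 𝒬 K →
        (Distribution.dsupport (RealPaleyWiener.fourierT T) ⊆ K ↔
          ∀ P ∈ 𝒬, RealPaleyWiener.growthExponent P f ≤ RealPaleyWiener.supOn P K)) ∧
    (∀ 𝒬 : Set (MvPolynomial (Fin d) ℂ),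
      RealPaleyWiener.Determines 𝒬 (Distribution.dsupport (RealPaleyWiener.fourierT T)) →
        ∀ ξ : RealPaleyWiener.Rd d,
          ξ ∈ Distribution.dsupport (RealPaleyWiener.fourierT T) ↔
            ∀ P ∈ 𝒬, ‖RealPaleyWiener.evalI P ξ‖ₑ ≤ RealPaleyWiener.growthExponent P f) ∧
    Distribution.dsupport (RealPaleyWiener.fourierT T) =
      {ξ : RealPaleyWiener.Rd d | ∀ P : MvPolynomial (Fin d) ℂ,
        ‖RealPaleyWiener.evalI P ξ‖ₑ ≤ RealPaleyWiener.growthExponent P f} := by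
  obtain ⟨hradius, hsubset, hmem⟩ := mainTheorem8_general d f hf T hT hsupp
  exact ⟨hradius, fun K _ _ => hsubset K, hmem⟩
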